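/- Notation. A transcendental entire function is a holomorphic $f:\mathbb{C}\to\mathbb{C}$ that is not a polynomial. Its set of singular values $S(f)$ is the smallest closed set $S\subset\mathbb{C}$ such that $f:\mathbb{C}\setminus f^{-1}(S)\to\mathbb{C}\setminus S$ is a covering map. Let $\mathcal{B}_{\mathrm{real}}$ be the set of all transcendental entire functions $f$ with $f(\mathbb{R})\subset\mathbb{R}$ for which $S(f)$ is bounded. For $f\in\mathcal{B}_{\mathrm{real}}$, let $\Sigma_0(f)$ be the set of signs $\sigma\in\{+1,-1\}$ with $\lim_{x\to+\infty}|f(\sigma x)|=\infty$. For $\sigma\in\Sigma_0(f)$, the function $f$ satisfies the sector condition at $\sigma\infty$ if for all sufficiently large $R>0$ there are $\vartheta>0$ and $R'>0$ such that $|f(\sigma x+y)|>R$ for all real $x>R'$ and all $y\in\mathbb{C}$ with $|y|<\vartheta x$. Theorem. Let $f\in\mathcal{B}_{\mathrm{real}}$ and $\sigma\in\Sigma_0(f)$. Then $f$ satisfies the sector condition at $\sigma\infty$ if and only if there exist constants $r,K>0$ such that \[ \frac{|f'(\sigma x)|}{|f(\sigma x)|}\le K\cdot\frac{\log|f(\sigma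 x)|}{x}\qquad\text{for all } x\ge r. \] -/

import Mathlib

open Filter Topology

/-- `f` is a transcendental entire function: it is holomorphic on `ℂ` and not a polynomial. -/
def IsTranscendentalEntire (f : ℂ → ℂ) : Prop :=
  Differentiable ℂ f ∧ ¬ ∃ p : Polynomial ℂ, ∀ z, f z = p.eval z

/-- `f` restricts to a covering map `ℂ \ f⁻¹(S) → ℂ \ S`. -/
def CoversOff (f : ℂ → ℂ) (S : Set ℂ) : Prop :=
  IsCoveringMap (Sᶜ.restrictPreimage f)

/-- The set `S(f)` of finite singular values: the smallest closed set `S` such that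
`f : ℂ \ f⁻¹(S) → ℂ \ S` is a covering map (see `isLeast_singularValues`). -/
def singularValues (f : ℂ → ℂ) : Set ℂ :=
  ⋂₀ {S : Set ℂ | IsClosed S ∧ CoversOff f S}

/-- For continuous `f`, the smallest closed set off which `f` is a covering map exists
and equals `singularValues f`. -/
theorem isLeast_singularValues {f : ℂ → ℂ} (hf : Continuous f) :
    IsLeast {S : Set ℂ | IsClosed S ∧ CoversOff f S} (singularValues f) := by
  refine ⟨⟨isClosed_sInter fun S hS => hS.1, ?_⟩, fun S hS => Set.sInter_subset_of_mem hS⟩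
  suffices h : IsCoveringMapOn f (singularValues f)ᶜ from h.isCoveringMap_restrictPreimage
  intro x hx
  simp only [singularValues, Set.mem_compl_iff, Set.mem_sInter, not_forall] at hx
  obtain ⟨S, ⟨hS, hcov⟩, hxS⟩ := hx
  exact IsCoveringMapOn.of_isCoveringMap_restrictPreimage _ hS.isOpen_compl
    (hS.isOpen_compl.preimage hf) hcov x hxS

/-- The class `B_real`: transcendental entire functions with `f(ℝ) ⊆ ℝ` and with a bounded
set of singular values. -/
def ClassBReal : Set (ℂ → ℂ) :=
  {f | IsTranscendentalEntire f ∧ (∀ x : ℝ, ∃ y : ℝ, f (x : ℂ) = (y : ℂ)) ∧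
    Bornology.IsBounded (singularValues f)}

/-- `Σ₀(f)`: the signs `σ ∈ {+1, -1}` for which `|f(σ x)| → ∞` as `x → +∞`. -/
def escapingSigns (f : ℂ → ℂ) : Set ℝ :=
  {σ | (σ = 1 ∨ σ = -1) ∧ Tendsto (fun x : ℝ => ‖f ((σ * x : ℝ) : ℂ)‖) atTop atTop}

/-- The (real) sector condition at `σ∞`: for all sufficiently large `R > 0` there are `ϑ > 0` and
`R' > 0` such that `|f(σ x + y)| > R` whenever `x > R'` and `y` is a complex number with
`|y| < ϑ x`. -/
def SectorCondition (f : ℂ → ℂ) (σ : ℝ) : Prop :=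
  ∃ R₀ > (0 : ℝ), ∀ R ≥ R₀, ∃ ϑ > (0 : ℝ), ∃ R' > (0 : ℝ),
    ∀ x : ℝ, R' < x → ∀ y : ℂ, ‖y‖ < ϑ * x → R < ‖f ((σ * x : ℝ) + y)‖

/-! Sector to derivative bound: a disc about `σx` of radius proportional to `x` lies in `|f| > 1`,
where `log |f|` is positive and harmonic, so its gradient at the centre is at most a constant times
`log |f| / x` (`norm_deriv_div_le_of_one_lt_norm`). Converse: for large `R`, `f` is a covering over
`|z| > R`, so `exp` on the half-plane `Re w > log R` lifts to `φ` with `f ∘ φ = exp`. As `f` is not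
a polynomial, `φ` is univalent (`injOn_of_comp_eq_exp`). A Koebe-type bound for `φ`
(`norm_deriv_mul_le_of_injOn`) shows that the distance from `z₀` to `|f| ≤ R` is at least a constant
times `(log |f z₀| - log R) |f z₀| / |f' z₀|`. At `z₀ = σx` the derivative bound makes this at least
a multiple of `x`, which is the sector. -/

/-- An entire function of polynomial growth is a polynomial. -/
theorem Differentiable.exists_polynomial_of_norm_le {f : ℂ → ℂ} (hf : Differentiable ℂ f)
    {C M : ℝ} {k : ℕ} (h : ∀ z, M ≤ ‖z‖ → ‖f z‖ ≤ C * ‖z‖ ^ k) :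
    ∃ p : Polynomial ℂ, ∀ z, f z = p.eval z := by
  have hzero : ∀ n, k < n → iteratedDeriv n f 0 = 0 := by
    intro n hn
    have hlim : Tendsto (fun r : ℝ => n.factorial * C * (r ^ (n - k))⁻¹) atTop (𝓝 0) := by
      have := (tendsto_inv_atTop_zero.comp
        (tendsto_pow_atTop (α := ℝ) (Nat.sub_ne_zero_of_lt hn))).const_mul (n.factorial * C)
      simpa using this
    refine norm_le_zero_iff.1 (ge_of_tendsto hlim ?_)
    filter_upwards [eventually_gt_atTop 0, eventually_ge_atTop M] with r hr hrM
    have := Complex.norm_iteratedDeriv_le_of_forall_mem_sphere_norm_le n hr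
      (hf.diffContOnCl (s := Metric.ball 0 r)) (C := C * r ^ k) (fun z hz => by
        have hz' : ‖z‖ = r := by simpa using hz
        simpa [hz'] using h z (by simpa [hz'] using hrM))
    refine this.trans_eq ?_
    have hsplit : r ^ n = r ^ (n - k) * r ^ k := by rw [← pow_add, Nat.sub_add_cancel hn.le]
    rw [hsplit]
    field_simp
  refine ⟨∑ n ∈ Finset.range (k + 1),
    Polynomial.monomial n ((n.factorial : ℂ)⁻¹ * iteratedDeriv n f 0), fun z => ?_⟩
  rw [← Complex.taylorSeries_eq_of_entire' 0 z hf, tsum_eq_sum (s := Finset.range (k + 1))]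
  · simp [Polynomial.eval_finsetSum]
  · intro n hn
    rw [hzero n (by simpa [Nat.lt_succ_iff] using hn)]
    simp

/-! ### Lifts through coverings and their holomorphy -/

section Lifts

variable {E X A : Type*} [TopologicalSpace E] [TopologicalSpace X] [TopologicalSpace A]

/-- Two lifts through a map that is covering on `s` agree on a preconnected set as soon as they
agree at a point. -/
theorem IsCoveringMapOn.eqOn_of_comp_eqOn {p : E → X} {s : Set X} (cov : IsCoveringMapOn p s)
    {t : Set A} (ht : IsPreconnected t) {g₁ g₂ : A → E} (h₁ : ContinuousOn g₁ t)
    (h₂ : ContinuousOn g₂ t) (hs : ∀ a ∈ t, p (g₁ a) ∈ s) (he : ∀ a ∈ t, p (g₁ a) = p (g₂ a))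
    {a : A} (ha : a ∈ t) (hag : g₁ a = g₂ a) : Set.EqOn g₁ g₂ t := by
  have : PreconnectedSpace t := Subtype.preconnectedSpace ht
  let G₁ : t → p ⁻¹' s := fun a => ⟨g₁ a, hs a a.2⟩
  let G₂ : t → p ⁻¹' s := fun a => ⟨g₂ a, by
    have := hs a a.2
    rwa [he a a.2] at this⟩
  have hG : G₁ = G₂ := by
    refine cov.isCoveringMap_restrictPreimage.eq_of_comp_eq
      ((continuousOn_iff_continuous_domRestrict.1 h₁).subtype_mk _)
      ((continuousOn_iff_continuous_domRestrict.1 h₂).subtype_mk _) ?_ ⟨a, ha⟩ (Subtype.ext hag)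
    funext b
    exact Subtype.ext (he b b.2)
  intro b hb
  exact congrArg Subtype.val (congrFun hG ⟨b, hb⟩)

/-- Continuous maps on open convex sets lift through maps that are covering on a set containing
the values; the lift is extended by zero. -/
theorem IsCoveringMapOn.exists_lift_of_convex {p : ℂ → X} {s : Set X}
    (cov : IsCoveringMapOn p s) {U : Set ℂ} (hU : IsOpen U) (hc : Convex ℝ U) {g : ℂ → X}
    (hg : ContinuousOn g U) (hs : ∀ w ∈ U, g w ∈ s) {w₀ z₀ : ℂ} (hw₀ : w₀ ∈ U)
    (h₀ : p z₀ = g w₀) :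
    ∃ φ : ℂ → ℂ, ContinuousOn φ U ∧ φ w₀ = z₀ ∧ (∀ w ∈ U, p (φ w) = g w) ∧
      ∀ w ∉ U, φ w = 0 := by
  classical
  have := hc.contractibleSpace ⟨w₀, hw₀⟩
  have := hU.locallyPathConnectedSpace
  obtain ⟨F, ⟨hF₀, hF⟩, -⟩ := cov.existsUnique_continuousMap_lifts
    (⟨U.domRestrict g, continuousOn_iff_continuous_domRestrict.1 hg⟩ : C(U, X))
    (a₀ := ⟨w₀, hw₀⟩) (e₀ := z₀) h₀ (fun a => hs a a.2)
  have hval : ∀ w : U, (if h : (w : ℂ) ∈ U then F ⟨w, h⟩ else 0) = F w := fun w => by simp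
  refine ⟨fun w => if h : w ∈ U then F ⟨w, h⟩ else 0, ?_, ?_, ?_, ?_⟩
  · rw [continuousOn_iff_continuous_domRestrict]
    exact F.continuous.congr fun w => (hval w).symm
  · simp [hw₀, hF₀]
  · intro w hw
    simpa [hw] using congrFun hF ⟨w, hw⟩
  · intro w hw
    simp [hw]

end Lifts

/-- A continuous lift through a holomorphic map with nonvanishing derivative is holomorphic. -/
theorem HasStrictDerivAt.hasDerivAt_lift {f φ g : ℂ → ℂ} {f' g' w : ℂ}
    (hf : HasStrictDerivAt f f' (φ w)) (hf' : f' ≠ 0) (hφ : ContinuousAt φ w)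
    (hg : HasDerivAt g g' w) (h : ∀ᶠ v in 𝓝 w, f (φ v) = g v) :
    HasDerivAt φ (f'⁻¹ * g') w := by
  have hgw : f (φ w) = g w := h.self_of_nhds
  have hinv := (hf.to_localInverse hf').hasDerivAt
  rw [hgw] at hinv
  refine (hinv.comp w hg).congr_of_eventuallyEq ?_
  filter_upwards [hφ.eventually (hf.hasStrictFDerivAt_equiv hf').eventually_left_inverse, h]
    with v hv hv'
  rw [Function.comp_apply, ← hv']
  exact hv.symm

/-- A continuous lift of a locally univalent map through a nonconstant entire function is
holomorphic. -/
theorem differentiableAt_of_comp_eq {f φ g : ℂ → ℂ} {g' w : ℂ}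
    (hf : Differentiable ℂ f) (hne : ∃ z, deriv f z ≠ 0)
    (hφ : ∀ᶠ v in 𝓝 w, ContinuousAt φ v) (hgd : ∀ᶠ v in 𝓝 w, DifferentiableAt ℂ g v)
    (hg : HasDerivAt g g' w) (hg' : g' ≠ 0) (h : ∀ᶠ v in 𝓝 w, f (φ v) = g v) :
    DifferentiableAt ℂ φ w := by
  have han : AnalyticOnNhd ℂ (deriv f) Set.univ := fun z _ => (hf.analyticAt z).deriv
  have hiso : ∀ᶠ z in 𝓝[≠] (φ w), deriv f z ≠ 0 := by
    refine (han (φ w) trivial).eventually_eq_zero_or_eventually_ne_zero.resolve_left fun h0 => ?_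
    obtain ⟨z, hz⟩ := hne
    exact hz (han.eqOn_zero_of_preconnected_of_eventuallyEq_zero isPreconnected_univ
      (Set.mem_univ _) h0 (Set.mem_univ z))
  -- `g` avoids `g w` near `w`, so `φ` avoids `φ w` there. Hence `φ` misses the critical points of
  -- `f`, and `w` is a removable singularity.
  have hφne : ∀ᶠ v in 𝓝[≠] w, φ v ≠ φ w := by
    filter_upwards [hg.eventually_ne (c := g w) hg', h.filter_mono nhdsWithin_le_nhds] with v hv hv'
    intro he
    exact hv (by rw [← hv', he, h.self_of_nhds])
  have hto : Tendsto φ (𝓝[≠] w) (𝓝[≠] (φ w)) :=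
    tendsto_nhdsWithin_iff.2 ⟨hφ.self_of_nhds.tendsto.mono_left nhdsWithin_le_nhds, hφne⟩
  refine (Complex.analyticAt_of_differentiable_on_punctured_nhds_of_continuousAt ?_
    hφ.self_of_nhds).differentiableAt
  filter_upwards [hto.eventually hiso, (eventually_eventually_nhds.2 h).filter_mono
    nhdsWithin_le_nhds, hφ.filter_mono nhdsWithin_le_nhds, hgd.filter_mono nhdsWithin_le_nhds]
    with v hv₁ hv₂ hv₃ hv₄
  exact ((hf.analyticAt (φ v)).hasStrictDerivAt.hasDerivAt_lift hv₁ hv₃ hv₄.hasDerivAt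
    hv₂).differentiableAt

/-- A holomorphic logarithm of a zero-free holomorphic function on an open convex set. -/
theorem exists_log_of_convex {U : Set ℂ} (hU : IsOpen U) (hc : Convex ℝ U)
    {g : ℂ → ℂ} (hg : DifferentiableOn ℂ g U) (hs : ∀ w ∈ U, g w ≠ 0) {w₀ z₀ : ℂ}
    (hw₀ : w₀ ∈ U) (h₀ : Complex.exp z₀ = g w₀) :
    ∃ L : ℂ → ℂ, L w₀ = z₀ ∧ (∀ w ∈ U, Complex.exp (L w) = g w) ∧
      ∀ w ∈ U, HasDerivAt L (deriv g w / g w) w := by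
  obtain ⟨L, hLc, hL₀, hL, -⟩ := Complex.isCoveringMapOn_exp.exists_lift_of_convex hU hc
    hg.continuousOn hs hw₀ h₀
  refine ⟨L, hL₀, hL, fun w hw => ?_⟩
  have hwU := hU.mem_nhds hw
  have := (Complex.hasStrictDerivAt_exp (L w)).hasDerivAt_lift (Complex.exp_ne_zero _)
    (hLc.continuousAt hwU) (hg.differentiableAt hwU).hasDerivAt
    (Filter.eventually_of_mem hwU hL)
  rwa [hL w hw, inv_mul_eq_div] at this

/-! ### Two derivative estimates -/

/-- A bound for the logarithmic derivative of a holomorphic function of modulus greater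
than one on a disc. -/
theorem norm_deriv_div_le_of_one_lt_norm {f : ℂ → ℂ} {c : ℂ} {r : ℝ} (hr : 0 < r)
    (hf : DifferentiableOn ℂ f (Metric.ball c r)) (h : ∀ z ∈ Metric.ball c r, 1 < ‖f z‖) :
    ‖deriv f c‖ / ‖f c‖ ≤ 2 * Real.exp 1 * (Real.log ‖f c‖ / r) := by
  have hne : ∀ z ∈ Metric.ball c r, f z ≠ 0 := fun z hz h0 => by
    have := h z hz
    simp only [h0, norm_zero] at this
    linarith
  have hc : c ∈ Metric.ball c r := Metric.mem_ball_self hr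
  obtain ⟨L, hL₀, hL, hL'⟩ := exists_log_of_convex Metric.isOpen_ball (convex_ball c r) hf hne hc
    (Complex.exp_log (hne c hc))
  have hre : ∀ z ∈ Metric.ball c r, (L z).re = Real.log ‖f z‖ := fun z hz => by
    rw [← hL z hz, Complex.norm_exp, Real.log_exp]
  set ℓ := Real.log ‖f c‖ with hℓ
  have hℓpos : 0 < ℓ := Real.log_pos (h c hc)
  -- `Re L > 0` gives `|G| ≤ 1`; dividing by `ℓ` normalises `|G c| = 1/e`, the source of the factor
  -- `e`.
  set G : ℂ → ℂ := fun z => Complex.exp (-(L z / ℓ)) with hG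
  have hGn : ∀ z ∈ Metric.ball c r, ‖G z‖ ≤ 1 := fun z hz => by
    rw [hG, Complex.norm_exp, Real.exp_le_one_iff, Complex.neg_re, Complex.div_ofReal_re, hre z hz,
      neg_nonpos]
    exact div_nonneg (Real.log_pos (h z hz)).le hℓpos.le
  have hGd : ∀ z ∈ Metric.ball c r, HasDerivAt G (G z * -(deriv f z / f z / ℓ)) z := fun z hz =>
    ((hL' z hz).div_const _).neg.cexp
  have hbound : ‖deriv G c‖ ≤ 2 / r := by
    refine Complex.norm_deriv_le_div_of_mapsTo_ball
      (fun z hz => (hGd z hz).differentiableAt.differentiableWithinAt) (fun z hz => ?_) hr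
    rw [mem_closedBall_iff_norm]
    linarith [norm_sub_le (G z) (G c), hGn z hz, hGn c hc]
  have hGc : ‖G c‖ = (Real.exp 1)⁻¹ := by
    rw [hG, Complex.norm_exp, Complex.neg_re, Complex.div_ofReal_re, hre c hc, ← hℓ,
      div_self hℓpos.ne', Real.exp_neg]
  rw [(hGd c hc).deriv, norm_mul, norm_neg, norm_div, norm_div, hGc, Complex.norm_real,
    Real.norm_of_nonneg hℓpos.le, inv_mul_eq_div, div_div, div_le_div_iff₀ (by positivity) hr]
    at hbound
  rw [← mul_div_assoc, le_div_iff₀ hr]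
  linarith

/-- A covering theorem of Koebe type: if `φ` is univalent on an open convex set `U`, omits `a`, and
has a continuous inverse branch on the disc about `φ w₀` with `a` on its boundary, then the radius
of that disc controls the derivative of `φ`. -/
theorem norm_deriv_mul_le_of_injOn {U : Set ℂ} (hU : IsOpen U) (hc : Convex ℝ U) {φ ψ : ℂ → ℂ}
    {w₀ a : ℂ} {ρ : ℝ} (hφ : DifferentiableOn ℂ φ U) (hinj : Set.InjOn φ U) (hρ : 0 < ρ)
    (hball : Metric.ball w₀ ρ ⊆ U) (ha : ∀ w ∈ U, φ w ≠ a)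
    (hψ : ContinuousOn ψ (Metric.ball (φ w₀) ‖a - φ w₀‖))
    (hψU : ∀ z ∈ Metric.ball (φ w₀) ‖a - φ w₀‖, ψ z ∈ U)
    (hφψ : ∀ z ∈ Metric.ball (φ w₀) ‖a - φ w₀‖, φ (ψ z) = z) :
    ‖deriv φ w₀‖ * ρ ≤ 48 * ‖a - φ w₀‖ := by
  have hw₀ : w₀ ∈ U := hball (Metric.mem_ball_self hρ)
  set b : ℂ := a - φ w₀ with hb
  have hb0 : b ≠ 0 := sub_ne_zero.2 (ha w₀ hw₀).symm
  have hbn : 0 < ‖b‖ := norm_pos_iff.2 hb0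
  obtain ⟨L, hL₀, hL, hL'⟩ := exists_log_of_convex hU hc
    (g := fun w => (a - φ w) / b) ((hφ.const_sub a).div_const b)
    (fun w hw => div_ne_zero (sub_ne_zero.2 (ha w hw).symm) hb0) hw₀ (z₀ := 0)
    (by simp [← hb, hb0])
  -- Koebe's square-root trick: `h` is the branch of `√((a - φ)/b)` with `h w₀ = 1`.
  set h : ℂ → ℂ := fun w => Complex.exp (L w / 2) with hh
  have hsq : ∀ w ∈ U, h w ^ 2 = (a - φ w) / b := fun w hw => by
    rw [← hL w hw, hh, ← Complex.exp_nat_mul]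
    congr 1
    push_cast
    ring
  have hhd : ∀ w ∈ U, HasDerivAt h (h w * (deriv (fun w => (a - φ w) / b) w /
      ((a - φ w) / b) / 2)) w := fun w hw => ((hL' w hw).div_const 2).cexp
  have hhc : ContinuousOn h U := fun w hw => (hhd w hw).continuousAt.continuousWithinAt
  have hφsub : ∀ w ∈ U, φ w - φ w₀ = b * (1 - h w ^ 2) := fun w hw => by
    rw [hsq w hw, mul_sub, mul_div_cancel₀ _ hb0, hb]
    ring
  have hz₀ : φ w₀ ∈ Metric.ball (φ w₀) ‖b‖ := Metric.mem_ball_self hbn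
  -- On the disc `|1 - h²| < 1` keeps `h` off the imaginary axis, so by connectedness `h` stays in
  -- the right half-plane.
  have hpos : ∀ z ∈ Metric.ball (φ w₀) ‖b‖, 0 < (h (ψ z)).re := by
    have hcont : ContinuousOn (fun z => (h (ψ z)).re) (Metric.ball (φ w₀) ‖b‖) :=
      Complex.continuous_re.comp_continuousOn
        (hhc.comp hψ hψU)
    have hne : ∀ z ∈ Metric.ball (φ w₀) ‖b‖, (h (ψ z)).re ≠ 0 := by
      intro z hz h0
      have h1 := hφsub _ (hψU z hz)
      rw [hφψ z hz] at h1
      have h2 : ‖b‖ * ‖1 - h (ψ z) ^ 2‖ < ‖b‖ * 1 := by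
        rw [← norm_mul, ← h1, mul_one]
        simpa [dist_eq_norm] using hz
      have h3 := (Complex.re_le_norm _).trans_lt (lt_of_mul_lt_mul_left h2 hbn.le)
      simp only [pow_two, Complex.sub_re, Complex.one_re, Complex.mul_re, h0] at h3
      nlinarith [mul_self_nonneg (h (ψ z)).im]
    have hone : h (ψ (φ w₀)) = 1 := by
      rw [hinj (hψU _ hz₀) hw₀ (hφψ _ hz₀), hh]
      simp [hL₀]
    intro z hz
    by_contra hneg
    obtain ⟨y, hy, hy0⟩ := (convex_ball (φ w₀) ‖b‖).isPreconnected.intermediate_value hz hz₀ hcont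
      (show (0 : ℝ) ∈ Set.Icc _ _ from ⟨not_lt.1 hneg, by simp [hone]⟩)
    exact hne y hy hy0
  -- If `h w` were within `1/3` of `-1`, then `|1 - h²| < 7/9` would put `φ w` in the disc;
  -- injectivity gives `ψ (φ w) = w`, contradicting `hpos`.
  have hfar : ∀ w ∈ U, 1 / 3 ≤ ‖1 + h w‖ := by
    intro w hw
    by_contra hlt
    push Not at hlt
    have h1 : ‖1 - h w‖ < 7 / 3 := by
      have : (1 : ℂ) - h w = 2 - (1 + h w) := by ring
      rw [this]
      have h2 : ‖(2 : ℂ)‖ = 2 := by simp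
      linarith [norm_sub_le (2 : ℂ) (1 + h w)]
    have hwz : φ w ∈ Metric.ball (φ w₀) ‖b‖ := by
      rw [mem_ball_iff_norm, hφsub w hw, norm_mul,
        show (1 : ℂ) - h w ^ 2 = (1 - h w) * (1 + h w) by ring, norm_mul]
      have : ‖1 - h w‖ * ‖1 + h w‖ < 1 := by
        nlinarith [norm_nonneg (1 - h w), norm_nonneg (1 + h w)]
      nlinarith
    have h3 := hpos _ hwz
    rw [hinj (hψU _ hwz) hw (hφψ _ hwz)] at h3
    have h4 := (Complex.re_le_norm _).trans_lt hlt
    simp only [Complex.add_re, Complex.one_re] at h4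
    linarith
  have hne1 : ∀ w ∈ U, 1 + h w ≠ 0 := fun w hw h0 => by
    have := hfar w hw
    rw [h0, norm_zero] at this
    linarith
  set G : ℂ → ℂ := fun w => (1 + h w)⁻¹ with hG
  have hGn : ∀ w ∈ U, ‖G w‖ ≤ 3 := fun w hw => by
    rw [hG, norm_inv, inv_le_comm₀ (by linarith [hfar w hw]) (by norm_num)]
    linarith [hfar w hw]
  have hGd : ∀ w ∈ U, HasDerivAt G (-(deriv h w) / (1 + h w) ^ 2) w := fun w hw =>
    ((hhd w hw).differentiableAt.hasDerivAt.const_add 1).inv (hne1 w hw)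
  -- Since `|G' w₀| = |φ' w₀| / (8|b|)`, this yields the constant `48 = 6 · 8`.
  have hbound : ‖deriv G w₀‖ ≤ 6 / ρ := by
    refine Complex.norm_deriv_le_div_of_mapsTo_ball
      (fun w hw => (hGd w (hball hw)).differentiableAt.differentiableWithinAt) (fun w hw => ?_) hρ
    rw [mem_closedBall_iff_norm]
    linarith [norm_sub_le (G w) (G w₀), hGn w (hball hw), hGn w₀ hw₀]
  have hh₀ : h w₀ = 1 := by simp [hh, hL₀]
  have hderiv : deriv h w₀ = -(deriv φ w₀) / b / 2 := by
    rw [(hhd w₀ hw₀).deriv, hh₀, ← hb, div_self hb0, deriv_div_const, deriv_const_sub]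
    ring
  rw [(hGd w₀ hw₀).deriv, hderiv, hh₀] at hbound
  norm_num [norm_div] at hbound
  rw [div_div, div_div, div_le_div_iff₀ (by positivity) hρ] at hbound
  linarith

/-! ### Univalence of the lift of `exp` -/

/-- A holomorphic lift of `exp` on a half-plane through an entire function that is not a polynomial
is not periodic. -/
theorem not_periodic_of_comp_eq_exp {f φ : ℂ → ℂ} (hf : Differentiable ℂ f)
    (hpoly : ¬ ∃ p : Polynomial ℂ, ∀ z, f z = p.eval z) {A : ℝ}
    (hφ : DifferentiableOn ℂ φ {w | A < w.re}) (hfφ : ∀ w, A < w.re → f (φ w) = Complex.exp w)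
    {k : ℕ} (hk : k ≠ 0)
    (hper : Function.Periodic φ (-(Complex.I * (2 * Real.pi * k : ℝ)))) : False := by
  apply hpoly
  set h : ℝ := 2 * Real.pi * k with hh
  have hpos : 0 < h := by positivity
  have hre : ∀ τ : ℂ, (-(Complex.I * τ)).re = τ.im := fun τ => by simp
  have hlarge : ∀ᶠ τ in comap Complex.im atTop, A < τ.im :=
    tendsto_comap.eventually (eventually_gt_atTop A)
  have hφtop : Tendsto (fun τ => φ (-(Complex.I * τ))) (comap Complex.im atTop)
      (Bornology.cobounded ℂ) := by
    have hcomp : Tendsto (fun τ => f (φ (-(Complex.I * τ)))) (comap Complex.im atTop)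
        (cocompact ℂ) := by
      rw [← Metric.cobounded_eq_cocompact, ← tendsto_norm_atTop_iff_cobounded]
      refine (Real.tendsto_exp_atTop.comp tendsto_comap).congr' ?_
      filter_upwards [hlarge] with τ hτ
      rw [hfφ _ (by rwa [hre]), Complex.norm_exp, hre, Function.comp_apply]
    rw [Metric.cobounded_eq_cocompact]
    exact (tendsto_comap_iff.2 hcomp).mono_right (comap_cocompact_le hf.continuous)
  set g : ℂ → ℂ := fun τ => (φ (-(Complex.I * τ)))⁻¹ with hg
  have hgper : Function.Periodic g h := fun τ => by
    have := hper (-(Complex.I * τ))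
    simp only [hg]
    rw [← this, mul_add, neg_add]
  have hφne : ∀ᶠ τ in comap Complex.im atTop, φ (-(Complex.I * τ)) ≠ 0 :=
    hφtop.eventually (Bornology.eventually_ne_cobounded 0)
  have hgd : ∀ᶠ τ in comap Complex.im atTop, DifferentiableAt ℂ g τ := by
    filter_upwards [hφne, hlarge] with τ h0 hτ
    have hopen : IsOpen {w : ℂ | A < w.re} := isOpen_lt continuous_const Complex.continuous_re
    have h1 : DifferentiableAt ℂ φ (-(Complex.I * τ)) :=
      hφ.differentiableAt (hopen.mem_nhds (by rwa [Set.mem_ofPred_eq, hre]))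
    exact (h1.comp τ (by fun_prop)).inv h0
  have hgz : ZeroAtFilter (comap Complex.im atTop) g := tendsto_inv₀_cobounded.comp hφtop
  -- `F` is `1/φ` in the variable `q = exp (2πiτ/h)`, with `F 0 = 0`. It is open at `0`, so `φ`
  -- takes every value near infinity.
  set F := Function.Periodic.cuspFunction h g with hF
  have hF0 : F 0 = 0 := Function.Periodic.cuspFunction_zero_of_zero_at_inf hpos hgz
  have hFd : DifferentiableAt ℂ F 0 :=
    Function.Periodic.differentiableAt_cuspFunction_zero hpos hgper hgd hgz.boundedAtFilter
  have hFa : AnalyticAt ℂ F 0 :=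
    Complex.analyticAt_of_differentiable_on_punctured_nhds_of_continuousAt
      (Function.Periodic.eventually_differentiableAt_cuspFunction_nhds_ne_zero hpos hgper hgd)
      hFd.continuousAt
  have hFq : ∀ q ≠ 0, F q = g (Function.Periodic.invQParam h q) := fun q hq =>
    Function.Periodic.cuspFunction_eq_of_nonzero _ _ hq
  have hFne : ∀ᶠ q in 𝓝[≠] (0 : ℂ), F q ≠ 0 := by
    filter_upwards [(Function.Periodic.invQParam_tendsto hpos).eventually hφne,
      self_mem_nhdsWithin] with q hq hq0
    rw [hFq q hq0]
    exact inv_ne_zero hq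
  have hopenF : 𝓝 (F 0) ≤ map F (𝓝 0) := by
    refine hFa.eventually_constant_or_nhds_le_map_nhds.resolve_left fun hconst => ?_
    obtain ⟨q, hq, hq'⟩ := (hFne.and (hconst.filter_mono nhdsWithin_le_nhds)).exists
    exact hq (hq'.trans hF0)
  obtain ⟨C, hC⟩ := hFd.isBigO_sub.bound
  have hA : ∀ᶠ q in 𝓝 (0 : ℂ), q ≠ 0 → A < (Function.Periodic.invQParam h q).im :=
    eventually_nhdsWithin_iff.1 ((Function.Periodic.invQParam_tendsto hpos).eventually hlarge)
  have himage := hopenF (image_mem_map (hC.and hA))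
  rw [hF0] at himage
  obtain ⟨ε, hε, hball⟩ := Metric.mem_nhds_iff.1 himage
  refine hf.exists_polynomial_of_norm_le (C := C ^ k) (M := 2 / ε) (k := k) fun z hz => ?_
  have hzpos : 0 < ‖z‖ := (div_pos two_pos hε).trans_le hz
  have hzmem : z⁻¹ ∈ Metric.ball (0 : ℂ) ε := by
    rw [mem_ball_zero_iff, norm_inv, inv_lt_comm₀ hzpos hε]
    refine lt_of_lt_of_le ?_ hz
    rw [inv_eq_one_div]
    gcongr
    norm_num
  obtain ⟨q, ⟨hq₁, hq₂⟩, hq⟩ := hball hzmem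
  have hz0 : z ≠ 0 := norm_pos_iff.1 hzpos
  have hq0 : q ≠ 0 := by
    rintro rfl
    exact inv_ne_zero hz0 (hq.symm.trans hF0)
  have hqpos : 0 < ‖q‖ := norm_pos_iff.2 hq0
  have hzφ : z = φ (-(Complex.I * Function.Periodic.invQParam h q)) := by
    rw [hFq q hq0] at hq
    exact (inv_injective hq).symm
  -- The period `2πk` makes `|exp w| = |q|⁻ᵏ`; with `|F q| ≤ C |q|` this bounds `|f z|` by `(C
  -- |z|)ᵏ`.
  have hnorm : ‖f z‖ = ‖q‖⁻¹ ^ k := by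
    rw [hzφ, hfφ _ (by rw [hre]; exact hq₂ hq0), Complex.norm_exp, hre,
      Function.Periodic.im_invQParam, ← Real.exp_log (inv_pos.2 hqpos), ← Real.exp_nat_mul,
      Real.log_inv, hh]
    congr 1
    field_simp
  have hle : ‖q‖⁻¹ ≤ C * ‖z‖ := by
    rw [hq, sub_zero, sub_zero, norm_inv, inv_le_iff_one_le_mul₀ hzpos] at hq₁
    rw [inv_le_iff_one_le_mul₀ hqpos]
    linarith
  rw [hnorm, ← mul_pow]
  gcongr

/-- A holomorphic lift of `exp` on a half-plane through a transcendental entire function that is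
covering over the corresponding exterior of a disc is univalent. -/
theorem injOn_of_comp_eq_exp {f φ : ℂ → ℂ} (hf : Differentiable ℂ f)
    (hpoly : ¬ ∃ p : Polynomial ℂ, ∀ z, f z = p.eval z) {A : ℝ}
    (cov : IsCoveringMapOn f {z | Real.exp A < ‖z‖})
    (hφ : DifferentiableOn ℂ φ {w | A < w.re}) (hfφ : ∀ w, A < w.re → f (φ w) = Complex.exp w)
    (hφ0 : ∀ w : ℂ, ¬ A < w.re → φ w = 0) : Set.InjOn φ {w | A < w.re} := by
  intro u hu v hv huv
  have hexp : Complex.exp u = Complex.exp v := by rw [← hfφ u hu, ← hfφ v hv, huv]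
  obtain ⟨n, hn⟩ := Complex.exp_eq_exp_iff_exists_int.1 hexp
  by_contra hne
  have hn0 : n ≠ 0 := by
    rintro rfl
    exact hne (by simpa using hn)
  set T : ℂ := n * (2 * Real.pi * Complex.I) with hT
  have hTre : T.re = 0 := by simp [hT]
  have hshift : ∀ w : ℂ, (w + T).re = w.re := fun w => by simp [hTre]
  -- `φ` and its translate by `T` lift the same map and agree at `v`.
  have hTper : Function.Periodic φ T := by
    have heq : Set.EqOn (fun w => φ (w + T)) φ {w | A < w.re} := by
      refine cov.eqOn_of_comp_eqOn (convex_halfSpace_re_gt A).isPreconnected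
        (hφ.continuousOn.comp (by fun_prop) fun w hw => ?_) hφ.continuousOn (fun w hw => ?_)
        (fun w hw => ?_) hv (by rw [← hn, huv])
      · rw [Set.mem_ofPred_eq, hshift]
        exact hw
      · rw [hfφ _ (by rw [hshift]; exact hw), Set.mem_ofPred_eq, Complex.norm_exp, hshift]
        exact Real.exp_lt_exp.2 hw
      · rw [hfφ _ (by rw [hshift]; exact hw), hfφ _ hw]
        exact Complex.exp_periodic.int_mul n w
    intro w
    -- Off the half-plane both sides are the default value `0`.
    by_cases hw : A < w.re
    · exact heq hw
    · rw [hφ0 w hw, hφ0 _ (by rwa [hshift])]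
  refine not_periodic_of_comp_eq_exp hf hpoly hφ hfφ (k := n.natAbs) (Int.natAbs_ne_zero.2 hn0) ?_
  rcases Int.natAbs_eq n with h | h
  · have hcast : (n : ℂ) = n.natAbs := by rw [← Int.cast_natCast, ← h]
    have hTn : -(Complex.I * (2 * Real.pi * n.natAbs : ℝ)) = -T := by
      rw [hT, hcast, Complex.ofReal_mul, Complex.ofReal_mul, Complex.ofReal_ofNat,
        Complex.ofReal_natCast]
      ring
    exact hTn ▸ hTper.neg
  · have hcast : (n : ℂ) = -n.natAbs := by rw [← Int.cast_natCast, ← Int.cast_neg, ← h]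
    have hTn : -(Complex.I * (2 * Real.pi * n.natAbs : ℝ)) = T := by
      rw [hT, hcast, Complex.ofReal_mul, Complex.ofReal_mul, Complex.ofReal_ofNat,
        Complex.ofReal_natCast]
      ring
    exact hTn ▸ hTper

/-! ### Distance to a sublevel set -/

/-- For a transcendental entire function that is covering over the exterior of the disc of radius
`R`, the distance to the points where the modulus is at most `R` is bounded below. -/
theorem log_mul_norm_le_of_isCoveringMapOn {f : ℂ → ℂ} (hf : Differentiable ℂ f)
    (hpoly : ¬ ∃ p : Polynomial ℂ, ∀ z, f z = p.eval z) {R : ℝ} (hR : 0 < R)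
    (cov : IsCoveringMapOn f {z | R < ‖z‖}) {z₀ a : ℂ} (hz₀ : R < ‖f z₀‖) (ha : ‖f a‖ ≤ R) :
    (Real.log ‖f z₀‖ - Real.log R) * ‖f z₀‖ ≤ 48 * ‖deriv f z₀‖ * ‖a - z₀‖ := by
  -- Taking `a` nearest to `z₀` keeps the open disc with `a` on its boundary inside `|f| > R`.
  wlog hmin : ∀ z, ‖f z‖ ≤ R → ‖a - z₀‖ ≤ ‖z - z₀‖ generalizing a
  · have hcl : IsClosed {z | ‖f z‖ ≤ R} := isClosed_le hf.continuous.norm continuous_const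
    obtain ⟨b, hb, hdist⟩ := hcl.exists_infDist_eq_dist ⟨a, ha⟩ z₀
    have hb' : ∀ z, ‖f z‖ ≤ R → ‖b - z₀‖ ≤ ‖z - z₀‖ := fun z hz => by
      rw [← dist_eq_norm, ← dist_eq_norm, dist_comm b, ← hdist, dist_comm z]
      exact Metric.infDist_le_dist_of_mem hz
    refine (this hb hb').trans ?_
    gcongr
    exact hb' a ha
  set A := Real.log R with hA
  have hRA : Real.exp A = R := Real.exp_log hR
  have hopen : IsOpen {w : ℂ | A < w.re} := isOpen_lt continuous_const Complex.continuous_re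
  have hmem : ∀ w : ℂ, A < w.re → Complex.exp w ∈ {z : ℂ | R < ‖z‖} := fun w hw => by
    rw [Set.mem_ofPred_eq, Complex.norm_exp, ← hRA]
    exact Real.exp_lt_exp.2 hw
  have hf0 : f z₀ ≠ 0 := norm_pos_iff.1 (hR.trans hz₀)
  set w₀ := Complex.log (f z₀) with hw₀def
  have hw₀re : w₀.re = Real.log ‖f z₀‖ := Complex.log_re _
  have hw₀ : A < w₀.re := by
    rw [hw₀re]
    exact Real.log_lt_log hR hz₀
  have hexpw₀ : Complex.exp w₀ = f z₀ := Complex.exp_log hf0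
  have hnonconst : ∃ z, deriv f z ≠ 0 := by
    by_contra! hall
    exact hpoly ⟨Polynomial.C (f 0), fun z => by
      rw [Polynomial.eval_C]
      exact is_const_of_deriv_eq_zero hf hall z 0⟩
  obtain ⟨φ, hφc, hφ₀, hφ, hφz⟩ := cov.exists_lift_of_convex hopen (convex_halfSpace_re_gt A)
    Complex.continuous_exp.continuousOn hmem hw₀ hexpw₀.symm
  have hφd : DifferentiableOn ℂ φ {w | A < w.re} := fun w hw => by
    have hnhds := hopen.mem_nhds hw
    refine (differentiableAt_of_comp_eq hf hnonconst
      (eventually_of_mem hnhds fun v hv => hφc.continuousAt (hopen.mem_nhds hv))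
      (Eventually.of_forall fun v => Complex.differentiable_exp v) (Complex.hasDerivAt_exp w)
      (Complex.exp_ne_zero w) (eventually_of_mem hnhds hφ)).differentiableWithinAt
  have hinj := injOn_of_comp_eq_exp hf hpoly (by rwa [hRA]) hφd hφ hφz
  have hderiv : deriv f z₀ * deriv φ w₀ = f z₀ := by
    have h1 : HasDerivAt (fun w => f (φ w)) (deriv f (φ w₀) * deriv φ w₀) w₀ :=
      (hf (φ w₀)).hasDerivAt.comp w₀ (hφd.differentiableAt (hopen.mem_nhds hw₀)).hasDerivAt
    have h2 := (Complex.hasDerivAt_exp w₀).congr_of_eventuallyEq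
      (eventually_of_mem (hopen.mem_nhds hw₀) hφ)
    rw [← hφ₀, h1.unique h2, hexpw₀, hφ₀]
  have hlarge : ∀ z ∈ Metric.ball z₀ ‖a - z₀‖, R < ‖f z‖ := fun z hz => by
    by_contra! hle
    rw [mem_ball_iff_norm] at hz
    exact (hmin z hle).not_gt hz
  have hd : 0 < ‖a - z₀‖ := norm_pos_iff.2 (sub_ne_zero.2 fun h => by
    rw [h] at ha
    exact ha.not_gt hz₀)
  have hz₀ball : z₀ ∈ Metric.ball z₀ ‖a - z₀‖ := Metric.mem_ball_self hd
  obtain ⟨ψ, hψ₀, hψ, hψ'⟩ := exists_log_of_convex Metric.isOpen_ball (convex_ball z₀ ‖a - z₀‖)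
    hf.differentiableOn (fun z hz => norm_pos_iff.1 (hR.trans (hlarge z hz))) hz₀ball hexpw₀
  have hψc : ContinuousOn ψ (Metric.ball z₀ ‖a - z₀‖) := fun z hz =>
    (hψ' z hz).continuousAt.continuousWithinAt
  have hψU : ∀ z ∈ Metric.ball z₀ ‖a - z₀‖, A < (ψ z).re := fun z hz => by
    rw [← Real.exp_lt_exp, hRA, ← Complex.norm_exp, hψ z hz]
    exact hlarge z hz
  -- Both `φ ∘ ψ` and the identity lift `f` through `f`, and they agree at `z₀`.
  have hφψ : Set.EqOn (fun z => φ (ψ z)) id (Metric.ball z₀ ‖a - z₀‖) := by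
    refine cov.eqOn_of_comp_eqOn (convex_ball z₀ ‖a - z₀‖).isPreconnected
      (hφc.comp hψc hψU) continuousOn_id (fun z hz => ?_) (fun z hz => ?_) hz₀ball
      (by rw [hψ₀, hφ₀, id])
    · rw [hφ _ (hψU z hz), hψ z hz]
      exact hlarge z hz
    · rw [hφ _ (hψU z hz), hψ z hz, id]
  have hkoebe := norm_deriv_mul_le_of_injOn hopen (convex_halfSpace_re_gt A) (φ := φ) (ψ := ψ)
    (w₀ := w₀) (a := a) (ρ := w₀.re - A) hφd hinj (sub_pos.2 hw₀) (fun w hw => by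
      rw [mem_ball_iff_norm] at hw
      have := (abs_le.1 (Complex.abs_re_le_norm (w - w₀))).1
      rw [Complex.sub_re] at this
      rw [Set.mem_ofPred_eq]
      linarith)
    (fun w hw h => by
      have h1 := hmem w hw
      rw [← hφ w hw, h] at h1
      exact ha.not_gt h1)
    (by rwa [hφ₀]) (by rwa [hφ₀]) (by rw [hφ₀]; exact hφψ)
  rw [hφ₀, hw₀re] at hkoebe
  calc (Real.log ‖f z₀‖ - A) * ‖f z₀‖
      = ‖deriv f z₀‖ * (‖deriv φ w₀‖ * (Real.log ‖f z₀‖ - A)) := by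
        rw [← hderiv, norm_mul]
        ring
    _ ≤ ‖deriv f z₀‖ * (48 * ‖a - z₀‖) := by gcongr
    _ = 48 * ‖deriv f z₀‖ * ‖a - z₀‖ := by ring

/-! ### The equivalence -/

theorem mainTheorem8 (f : ℂ → ℂ) (hf : f ∈ ClassBReal) (σ : ℝ) (hσ : σ ∈ escapingSigns f) :
    SectorCondition f σ ↔
      ∃ r > (0 : ℝ), ∃ K > (0 : ℝ), ∀ x : ℝ, r ≤ x →
        ‖deriv f ((σ * x : ℝ) : ℂ)‖ / ‖f ((σ * x : ℝ) : ℂ)‖ ≤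
          K * (Real.log ‖f ((σ * x : ℝ) : ℂ)‖ / x) := by
  obtain ⟨⟨hfd, hpoly⟩, -, hbdd⟩ := hf
  obtain ⟨-, hlim⟩ := hσ
  constructor
  · rintro ⟨R₀, -, hsec⟩
    obtain ⟨ϑ, hϑ, R', hR', h⟩ := hsec (max R₀ 1) (le_max_left _ _)
    refine ⟨R' + 1, by linarith, 2 * Real.exp 1 / ϑ, by positivity, fun x hx => ?_⟩
    have hx0 : 0 < x := by linarith
    refine (norm_deriv_div_le_of_one_lt_norm (mul_pos hϑ hx0) hfd.differentiableOn
      fun z hz => ?_).trans_eq (by field_simp)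
    have := h x (by linarith) (z - (σ * x : ℝ)) (by rwa [← mem_ball_iff_norm])
    rw [add_sub_cancel] at this
    exact (le_max_right _ _).trans_lt this
  · rintro ⟨r, hr, K, hK, h⟩
    obtain ⟨R₁, hR₁⟩ := hbdd.subset_closedBall 0
    refine ⟨max R₁ 1, by positivity, fun R hR => ?_⟩
    have hR1 : 1 ≤ R := (le_max_right _ _).trans hR
    have hR0 : 0 < R := one_pos.trans_le hR1
    have cov : IsCoveringMapOn f {z | R < ‖z‖} := by
      have hclosed := (isLeast_singularValues hfd.continuous).1.1
      have := IsCoveringMapOn.of_isCoveringMap_restrictPreimage _ hclosed.isOpen_compl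
        (hclosed.isOpen_compl.preimage hfd.continuous)
        (isLeast_singularValues hfd.continuous).1.2
      refine this.mono fun z hz hzS => ?_
      have h1 : ‖z‖ ≤ R₁ := by simpa using hR₁ hzS
      exact (h1.trans ((le_max_left _ _).trans hR)).not_gt hz
    -- `|f| > R²` gives `log |f| - log R ≥ (log |f|)/2`; this factor `2` and the constant `48` make
    -- the `96` in `ϑ`.
    obtain ⟨x₁, hx₁⟩ := eventually_atTop.1 (hlim.eventually_gt_atTop (R ^ 2))
    refine ⟨1 / (96 * K), by positivity, max r x₁, lt_max_of_lt_left hr, fun x hx y hy => ?_⟩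
    have hxr : r < x := (le_max_left _ _).trans_lt hx
    have hx0 : 0 < x := hr.trans hxr
    have hbig := hx₁ x ((le_max_right _ _).trans hx.le)
    have hbound := h x hxr.le
    set z₀ : ℂ := ((σ * x : ℝ) : ℂ)
    have hRz : R < ‖f z₀‖ := by nlinarith
    have hfz : 0 < ‖f z₀‖ := hR0.trans hRz
    have hlog : 2 * Real.log R ≤ Real.log ‖f z₀‖ := by
      have := Real.log_le_log (by positivity) hbig.le
      rwa [Real.log_pow, Nat.cast_ofNat] at this
    have hlogpos : 0 < Real.log ‖f z₀‖ := Real.log_pos (hR1.trans_lt hRz)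
    by_contra! hle
    have hdist := log_mul_norm_le_of_isCoveringMapOn hfd hpoly hR0 cov hRz hle
    rw [add_sub_cancel_left] at hdist
    rw [div_le_iff₀ hfz] at hbound
    have hy' : 96 * K * ‖y‖ < x := by
      rw [div_mul_eq_mul_div, one_mul, lt_div_iff₀ (by positivity)] at hy
      linarith
    have hchain : Real.log ‖f z₀‖ / 2 * ‖f z₀‖ ≤
        48 * (K * (Real.log ‖f z₀‖ / x) * ‖f z₀‖) * ‖y‖ := by
      refine le_trans ?_ (hdist.trans ?_)
      · gcongr
        linarith
      · gcongr
    have hmul : x ≤ 96 * K * ‖y‖ := by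
      have hpos : 0 < Real.log ‖f z₀‖ * ‖f z₀‖ / (2 * x) := by positivity
      refine le_of_mul_le_mul_left ?_ hpos
      calc _ = Real.log ‖f z₀‖ / 2 * ‖f z₀‖ := by field_simp
        _ ≤ _ := hchain
        _ = _ := by
          field_simp
          ring
    exact hmul.not_gt hy'
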